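/- **Proposition 3.1 (product Bernstein–Walsh inequality).** For a compact convex set $A\subset\mathbb{R}^n$ let $\varphi_A(\xi)=\sup_{x\in A}\langle x,\xi\rangle$ be its supporting function. For a compact convex set $S\subset\mathbb{R}^n_+$ with $0\in S$ let $H_S(z)=\varphi_S(\log|z_1|,\dots,\log|z_n|)$ for $z\in\mathbb{C}^{*n}=(\mathbb{C}\setminus\{0\})^n$ and $H_S(z)=\limsup_{\mathbb{C}^{*n}\ni w\to z}H_S(w)$ for $z\in\mathbb{C}^n\setminus\mathbb{C}^{*n}$. Let $\mathcal{L}^S(\mathbb{C}^n)$ be the class of plurisubharmonic functions $u$ on $\mathbb{C}^n$ with $u\le H_S+c_u$ for some constant $c_u$. For compact $K\subset\mathbb{C}^n$ let $$V^S_K(z)=\sup\{u(z)\,;\,u\in\mathcal{L}^S(\mathbb{C}^n),\ u|_K\le 0\},\qquad z\in\mathbb{C}^n,$$ a function with values in $[0,\infty]$. For compact convex $S\subset\mathbb{R}^n_+$ and $m\in\mathbb{N}=\{0,1,2,\dots\}$ let $\mathcal{P}^S_m(\mathbb{C}^n)$ be the set of polynomials of the form $f(z)=\sum_{\alpha\in(mS)\cap\mathbb{N}^n}c_\alpha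 z^\alpha$. Let $K_j\subset\mathbb{C}^{n_j}$ be compact and non-pluripolar for $j=1,\dots,\ell$, $K=K_1\times\dots\times K_\ell$, and $n=n_1+\dots+n_\ell$. Let $T\subset\mathbb{R}^\ell_+$ be compact convex, let $S_j\subset\mathbb{R}^{n_j}_+$ be compact convex with $0\in S_j$ for $j=1,\dots,\ell$, and let $$S=\bigcup_{x\in T}(x_1S_1)\times\dots\times(x_\ell S_\ell)\subset\mathbb{R}^n_+.$$ Then for every $m\in\mathbb{N}$, every $f\in\mathcal{P}^S_m(\mathbb{C}^n)$ and every $z=(z_1,\dots,z_\ell)\in\mathbb{C}^n$, $z_j\in\mathbb{C}^{n_j}$, $$|f(z)|\le\|f\|_{L^\infty(K)}\,\exp\bigl(m\,\varphi_T(V^{S_1}_{K_1}(z_1),\dots,V^{S_\ell}_{K_\ell}(z_\ell))\bigr),$$ where $\|f\|_{L^\infty(K)}=\sup_{w\in K}|f(w)|$ and the right-hand side is read in $[0,\infty]$ with $0\cdot\infty=0$. -/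

import Mathlib

open MeasureTheory Set Filter Topology
open scoped ENNReal Pointwise

noncomputable section

/-- The supporting function `φ_A(ξ) = sup_{x ∈ A} ⟨x, ξ⟩` of `A ⊆ ℝ^ι`, with values in the
extended reals and evaluated at extended real vectors (with `0 * (±∞) = 0`). At a real vector `ξ`
this is the usual supremum. -/
def supportFun {ι : Type*} [Fintype ι] (A : Set (ι → ℝ)) (ξ : ι → EReal) : EReal :=
  ⨆ x ∈ A, ∑ i, (x i : EReal) * ξ i

/-- `ℂ^{*n}`: the points of `ℂ^n` all of whose coordinates are nonzero. -/
def complexTorus (ι : Type*) : Set (ι → ℂ) := {z | ∀ i, z i ≠ 0}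

/-- `Log z = (log |z_1|, …, log |z_n|)`, used for `z ∈ ℂ^{*n}`. -/
def logAbs {ι : Type*} (z : ι → ℂ) : ι → EReal := fun i => ((Real.log ‖z i‖ : ℝ) : EReal)

open Classical in
/-- The logarithmic supporting function `H_S`: it is `φ_S(Log z)` on `ℂ^{*n}` and
`limsup_{ℂ^{*n} ∋ w → z} φ_S(Log w)` off `ℂ^{*n}`. -/
def logSupportFun {ι : Type*} [Fintype ι] (S : Set (ι → ℝ)) (z : ι → ℂ) : EReal :=
  if z ∈ complexTorus ι then supportFun S (logAbs z)
  else limsup (fun w => supportFun S (logAbs w)) (𝓝[complexTorus ι] z)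

/-- The mean over `[0, 2π]` of an extended real valued function, as the mean of its positive part
minus the mean of its negative part. It is used for functions that are bounded above, so that
`∞ - ∞` does not occur. -/
def circleMean (v : ℝ → EReal) : EReal :=
  ((laverage (volume.restrict (Ioc 0 (2 * Real.pi))) fun θ => (v θ).toENNReal : ℝ≥0∞) : EReal)
    - ((laverage (volume.restrict (Ioc 0 (2 * Real.pi))) fun θ => (-(v θ)).toENNReal : ℝ≥0∞) : EReal)

/-- Plurisubharmonic functions `u : ℂ^n → [-∞, ∞)`: upper semicontinuous, and satisfying the
sub-mean value inequality on every circle in every complex line. The function that is identically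
`-∞` is allowed. -/
structure IsPSH {ι : Type*} (u : (ι → ℂ) → EReal) : Prop where
  ne_top : ∀ z, u z ≠ ⊤
  upperSemicontinuous : UpperSemicontinuous u
  le_circleMean : ∀ a b : ι → ℂ,
    u a ≤ circleMean (fun θ : ℝ => u (a + Complex.exp (θ * Complex.I) • b))

/-- `E ⊆ ℂ^n` is pluripolar if it lies in the `-∞` set of a plurisubharmonic function on `ℂ^n`
that is not identically `-∞`. -/
def IsPluripolar {ι : Type*} (E : Set (ι → ℂ)) : Prop :=
  ∃ u : (ι → ℂ) → EReal, IsPSH u ∧ (∃ z, u z ≠ ⊥) ∧ ∀ z ∈ E, u z = ⊥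

/-- The Lelong class `𝓛^S(ℂ^n)`: plurisubharmonic `u` with `u ≤ H_S + c` for a constant `c`. -/
def lelongClass {ι : Type*} [Fintype ι] (S : Set (ι → ℝ)) : Set ((ι → ℂ) → EReal) :=
  {u | IsPSH u ∧ ∃ c : ℝ, ∀ z, u z ≤ logSupportFun S z + (c : EReal)}

/-- The (unweighted) Siciak–Zakharyuta function
`V^S_K = sup {u : u ∈ 𝓛^S(ℂ^n), u ≤ 0 on K}`, as a pointwise supremum in the extended reals. -/
def siciakZakharyuta {ι : Type*} [Fintype ι] (S : Set (ι → ℝ)) (K : Set (ι → ℂ))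
    (z : ι → ℂ) : EReal :=
  ⨆ u ∈ {u | u ∈ lelongClass S ∧ ∀ w ∈ K, u w ≤ 0}, u z

/-- `𝓟^S_m(ℂ^n)`: polynomials all of whose exponents lie in `mS ∩ ℕ^n`. -/
def polyClass {ι : Type*} (S : Set (ι → ℝ)) (m : ℕ) : Set (MvPolynomial ι ℂ) :=
  {f | ∀ α ∈ f.support, (fun i => (α i : ℝ)) ∈ (m : ℝ) • S}

/-- The `j`-th block `z_j ∈ X^{n_j}` of `z = (z_1, …, z_ℓ) ∈ X^n`, `n = n_1 + ⋯ + n_ℓ`, where the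
coordinates of `X^n` are indexed by the pairs `(j, i)` with `1 ≤ j ≤ ℓ`, `1 ≤ i ≤ n_j`. -/
def block {l : ℕ} {n : Fin l → ℕ} {X : Type*} (z : (Σ j, Fin (n j)) → X) (j : Fin l) :
    Fin (n j) → X := fun i => z ⟨j, i⟩

/-- The product `K_1 × ⋯ × K_ℓ ⊆ X^n` of sets `K_j ⊆ X^{n_j}`. -/
def blockProd {l : ℕ} {n : Fin l → ℕ} {X : Type*} (K : ∀ j, Set (Fin (n j) → X)) :
    Set ((Σ j, Fin (n j)) → X) := {z | ∀ j, block z j ∈ K j}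

/-- `S = ⋃_{x ∈ T} (x_1 S_1) × ⋯ × (x_ℓ S_ℓ)`. -/
def scaledProdUnion {l : ℕ} {n : Fin l → ℕ} (T : Set (Fin l → ℝ))
    (S : ∀ j, Set (Fin (n j) → ℝ)) : Set ((Σ j, Fin (n j)) → ℝ) :=
  ⋃ x ∈ T, blockProd fun j => x j • S j

/-- The sup norm `‖f‖_{L^∞(K)} = sup_{w ∈ K} |f(w)|` of a polynomial on `K`. -/
def supNormOn {ι : Type*} (K : Set (ι → ℂ)) (f : MvPolynomial ι ℂ) : ℝ≥0∞ :=
  ⨆ w ∈ K, ‖MvPolynomial.eval w f‖ₑ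

end

/-! ### Plurisubharmonicity of `log |q|` -/

/-! The inequality is first proved with an extra factor polynomial in the degree
(`enorm_eval_le_mul_supNormOn_mul_exp`). It is then applied to `f ^ k`, which has exponents in `(m *
k) • S` because `S` is convex, and `k`-th roots remove the factor as `k → ∞`. No product formula for
the extremal functions is used.

For the weak form, each block gets a basis `q a` of the polynomials of degree at most `N` in each
variable (`exists_expansion_monomials`). It is triangular with respect to an ordering of the
monomials that makes every `t • S j` an initial segment, so one basis serves all `t` at once.
Orthonormalizing the vectors of values at Fekete points of `K j` bounds `q a` on `K j` by the
dimension, and gives each coefficient as a combination of point values on `K j` with weights of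
modulus at most 1.

Expand `f` in tensor products of these bases. The coefficients are controlled by the values of `f`
on the product of the `K j`. A nonzero coefficient comes from some exponent of `f`, whose blocks lie
in `(m * x j) • S j` for a common `x ∈ T`. By triangularity the factors then have exponents in these
sets, so the one-set inequality (`enorm_eval_le_exp_siciakZakharyuta`) bounds their product by `exp
(m * ∑ x j * V j)`, up to the dimensions. -/

lemma Polynomial.norm_eval_zero_le_mahlerMeasure (p : Polynomial ℂ) :
    ‖p.eval 0‖ ≤ p.mahlerMeasure := by
  simpa [Polynomial.coeff_zero_eq_eval_zero] using p.norm_coeff_le_choose_mul_mahlerMeasure 0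

lemma circleMean_eq_coe {v : ℝ → EReal} {h : ℝ → ℝ}
    (hi : IntervalIntegrable h volume 0 (2 * Real.pi))
    (hv : ∀ᵐ θ, v θ = ((h θ : ℝ) : EReal)) :
    circleMean v = (((2 * Real.pi)⁻¹ * ∫ θ in (0)..(2 * Real.pi), h θ : ℝ) : EReal) := by
  have hpi : (0 : ℝ) ≤ 2 * Real.pi := Real.two_pi_pos.le
  have hint : Integrable h (volume.restrict (Ioc 0 (2 * Real.pi))) :=
    (intervalIntegrable_iff_integrableOn_Ioc_of_le hpi).1 hi
  have hv' := ae_restrict_of_ae (s := Ioc 0 (2 * Real.pi)) hv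
  have h1 : (fun θ => (v θ).toENNReal) =ᵐ[volume.restrict (Ioc 0 (2 * Real.pi))]
      fun θ => ENNReal.ofReal (h θ) := by
    filter_upwards [hv'] with θ hθ
    rw [hθ, EReal.toENNReal_of_ne_top (EReal.coe_ne_top _), EReal.toReal_coe]
  have h2 : (fun θ => (-(v θ)).toENNReal) =ᵐ[volume.restrict (Ioc 0 (2 * Real.pi))]
      fun θ => ENNReal.ofReal (-h θ) := by
    filter_upwards [hv'] with θ hθ
    rw [hθ, ← EReal.coe_neg, EReal.toENNReal_of_ne_top (EReal.coe_ne_top _), EReal.toReal_coe]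
  have key : ∀ A : ℝ≥0∞, A ≠ ⊤ → ((A / ENNReal.ofReal (2 * Real.pi) : ℝ≥0∞) : EReal)
      = ((A.toReal / (2 * Real.pi) : ℝ) : EReal) := by
    intro A hA
    rw [← EReal.coe_toReal (x := ((A / ENNReal.ofReal (2 * Real.pi) : ℝ≥0∞) : EReal))]
    · rw [EReal.toReal_coe_ennreal, ENNReal.toReal_div, ENNReal.toReal_ofReal hpi]
    · simpa using (ENNReal.div_lt_top hA (by simpa using Real.pi_pos)).ne
    · simp
  have hA : ∫⁻ θ in Ioc 0 (2 * Real.pi), ENNReal.ofReal (h θ) ≠ ⊤ := by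
    simpa using hint.lintegral_lt_top.ne
  have hB : ∫⁻ θ in Ioc 0 (2 * Real.pi), ENNReal.ofReal (-h θ) ≠ ⊤ := by
    simpa using hint.neg.lintegral_lt_top.ne
  rw [circleMean, laverage_congr h1, laverage_congr h2, laverage_eq, laverage_eq,
    intervalIntegral.integral_of_le hpi,
    integral_eq_lintegral_pos_part_sub_lintegral_neg_part hint]
  simp only [Measure.restrict_apply_univ, Real.volume_Ioc, sub_zero]
  rw [key _ hA, key _ hB, ← EReal.coe_sub]
  congr 1
  ring

lemma log_enorm_rpow_eq_coe {x : ℂ} (hx : x ≠ 0) (s : ℝ) :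
    ENNReal.log (‖x‖ₑ ^ s) = ((s * Real.log ‖x‖ : ℝ) : EReal) := by
  rw [ENNReal.log_rpow, ENNReal.log_pos_real (by simpa using hx) (by simp)]
  simp

lemma continuous_log_enorm_rpow {ι : Type*} (q : MvPolynomial ι ℂ) (s : ℝ) :
    Continuous fun z => ENNReal.log (‖MvPolynomial.eval z q‖ₑ ^ s) :=
  ENNReal.continuous_log.comp
    ((ENNReal.continuous_rpow_const).comp (MvPolynomial.continuous_eval q).enorm)

lemma eval_add_smul_eq_eval_aeval {ι : Type*} (q : MvPolynomial ι ℂ) (a b : ι → ℂ) (ζ : ℂ) :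
    MvPolynomial.eval (a + ζ • b) q = (MvPolynomial.aeval
      (fun i => Polynomial.C (a i) + Polynomial.X * Polynomial.C (b i)) q).eval ζ := by
  induction q using MvPolynomial.induction_on with
  | C c => simp
  | add p q hp hq => simp [hp, hq]
  | mul_X p i hp =>
    simp only [map_mul, MvPolynomial.eval_X, hp, Polynomial.eval_mul, MvPolynomial.aeval_X]
    simp only [Polynomial.eval_add, Polynomial.eval_mul, Polynomial.eval_C, Polynomial.eval_X,
      Pi.add_apply, Pi.smul_apply, smul_eq_mul]

/-- On a complex line `q` becomes a one-variable polynomial, and the sub-mean value inequality is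
the Mahler measure bound for its constant term. -/
lemma isPSH_log_enorm_rpow {ι : Type*} (q : MvPolynomial ι ℂ) {s : ℝ} (hs : 0 < s) :
    IsPSH fun z => ENNReal.log (‖MvPolynomial.eval z q‖ₑ ^ s) where
  ne_top z := by simp [hs.le]
  upperSemicontinuous := (continuous_log_enorm_rpow q s).upperSemicontinuous
  le_circleMean a b := by
    by_cases ha : MvPolynomial.eval a q = 0
    · simp [ha, hs]
    set g : Polynomial ℂ :=
      MvPolynomial.aeval (fun i => Polynomial.C (a i) + Polynomial.X * Polynomial.C (b i)) q with hg
    have hgq : ∀ ζ : ℂ, MvPolynomial.eval (a + ζ • b) q = g.eval ζ :=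
      fun ζ => eval_add_smul_eq_eval_aeval q a b ζ
    have hg0 : g.eval 0 = MvPolynomial.eval a q := by simpa using (hgq 0).symm
    have hgne : g ≠ 0 := by
      rintro h
      rw [h] at hg0
      simp at hg0
      exact ha hg0.symm
    -- Finitely many roots meet the circle in a null set of angles, so the value `-∞` does not
    -- affect the mean.
    have hae : ∀ᵐ θ : ℝ, g.eval (circleMap 0 1 θ) ≠ 0 := by
      have : ({x | g.IsRoot x} : Set ℂ).Countable :=
        (Polynomial.finite_setOfPred_isRoot hgne).countable
      exact (this.preimage_circleMap 0 one_ne_zero).ae_notMem volume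
    have hmap : ∀ θ : ℝ, Complex.exp (θ * Complex.I) = circleMap 0 1 θ := by
      intro θ; simp [circleMap]
    have hi : IntervalIntegrable (fun θ => s * Real.log ‖g.eval (circleMap 0 1 θ)‖) volume 0
        (2 * Real.pi) := (g.intervalIntegrable_mahlerMeasure).const_mul s
    rw [circleMean_eq_coe (h := fun θ => s * Real.log ‖g.eval (circleMap 0 1 θ)‖) hi,
      log_enorm_rpow_eq_coe ha, EReal.coe_le_coe_iff, intervalIntegral.integral_const_mul]
    · have h1 : Real.log ‖MvPolynomial.eval a q‖ ≤ g.logMahlerMeasure := by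
        rw [Polynomial.logMahlerMeasure_eq_log_MahlerMeasure, ← hg0]
        exact Real.log_le_log (by simpa [hg0] using ha) g.norm_eval_zero_le_mahlerMeasure
      rw [Polynomial.logMahlerMeasure_def, Real.circleAverage_def, smul_eq_mul] at h1
      calc _ ≤ s * _ := mul_le_mul_of_nonneg_left h1 hs.le
        _ = _ := by ring
    · filter_upwards [hae] with θ hθ
      rw [hmap, hgq, log_enorm_rpow_eq_coe hθ]

lemma exists_eval_ne_zero_of_not_isPluripolar {ι : Type*} {K : Set (ι → ℂ)}
    (hK : ¬ IsPluripolar K) {q : MvPolynomial ι ℂ} (hq : q ≠ 0) :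
    ∃ w ∈ K, MvPolynomial.eval w q ≠ 0 := by
  by_contra! h
  refine hK ⟨_, isPSH_log_enorm_rpow q one_pos, ?_, fun z hz => by simp [h z hz]⟩
  by_contra! h'
  exact hq (MvPolynomial.funext fun z => by simpa using h' z)

/-! ### The Bernstein–Walsh inequality for one set -/

lemma dense_complexTorus (ι : Type*) : Dense (complexTorus ι) := by
  have : complexTorus ι = Set.pi univ fun _ : ι => ({0} : Set ℂ)ᶜ := by
    ext z; simp [complexTorus]
  rw [this]
  exact dense_pi univ fun i _ => dense_compl_singleton 0

lemma prod_enorm_pow_le_exp_supportFun {ι : Type*} [Fintype ι] {S : Set (ι → ℝ)} {t : ℝ}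
    (ht : 0 ≤ t) {α : ι →₀ ℕ} (hα : (fun i => (α i : ℝ)) ∈ t • S) {z : ι → ℂ}
    (hz : z ∈ complexTorus ι) :
    ∏ i, ‖z i‖ₑ ^ α i ≤ EReal.exp (supportFun S (logAbs z)) ^ t := by
  obtain ⟨x, hx, hxα⟩ := hα
  have hle : ((∑ i, x i * Real.log ‖z i‖ : ℝ) : EReal) ≤ supportFun S (logAbs z) := by
    refine le_trans (le_of_eq ?_) (le_iSup₂ (f := fun (y : ι → ℝ) (_ : y ∈ S) =>
      ∑ i, (y i : EReal) * logAbs z i) x hx)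
    have hcoe : ((∑ i, x i * Real.log ‖z i‖ : ℝ) : EReal) =
        ∑ i, ((x i * Real.log ‖z i‖ : ℝ) : EReal) :=
      map_sum (⟨⟨Real.toEReal, EReal.coe_zero⟩, EReal.coe_add⟩ : ℝ →+ EReal) _ _
    simp [logAbs, hcoe]
  have h1 : ∏ i, ‖z i‖ₑ ^ α i = EReal.exp ((∑ i, x i * Real.log ‖z i‖ : ℝ) : EReal) ^ t := by
    rw [EReal.exp_coe, ENNReal.ofReal_rpow_of_pos (Real.exp_pos _), ← Real.exp_mul,
      Finset.sum_mul, Real.exp_sum, ENNReal.ofReal_prod_of_nonneg fun _ _ => (Real.exp_pos _).le]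
    refine Finset.prod_congr rfl fun i _ => ?_
    have hi : (α i : ℝ) = t * x i := (congrFun hxα i).symm
    rw [show x i * Real.log ‖z i‖ * t = Real.log ‖z i‖ * (α i : ℝ) by rw [hi]; ring,
      Real.exp_mul, Real.exp_log (by simpa using hz i), Real.rpow_natCast,
      ENNReal.ofReal_pow (norm_nonneg _), ofReal_norm]
  rw [h1]
  exact ENNReal.rpow_le_rpow (EReal.exp_monotone hle) ht

lemma enorm_eval_le_exp_supportFun {ι : Type*} [Fintype ι] {S : Set (ι → ℝ)} {t : ℝ}
    (ht : 0 ≤ t) {q : MvPolynomial ι ℂ} (hq : ∀ α ∈ q.support, (fun i => (α i : ℝ)) ∈ t • S)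
    {z : ι → ℂ} (hz : z ∈ complexTorus ι) :
    ‖MvPolynomial.eval z q‖ₑ ≤
      (∑ α ∈ q.support, ‖q.coeff α‖ₑ) * EReal.exp (supportFun S (logAbs z)) ^ t := by
  rw [MvPolynomial.eval_eq', Finset.sum_mul]
  refine (enorm_sum_le _ _).trans (Finset.sum_le_sum fun α hα => ?_)
  rw [enorm_mul]
  gcongr
  refine le_trans (le_of_eq ?_) (prod_enorm_pow_le_exp_supportFun ht (hq α hα) hz)
  rw [← ofReal_norm, norm_prod, ENNReal.ofReal_prod_of_nonneg fun _ _ => norm_nonneg _]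
  simp

lemma log_enorm_rpow_mem_lelongClass {ι : Type*} [Fintype ι] {S : Set (ι → ℝ)} {t : ℝ}
    (ht : 0 < t) {q : MvPolynomial ι ℂ} (hq : ∀ α ∈ q.support, (fun i => (α i : ℝ)) ∈ t • S) :
    (fun z => ENNReal.log (‖MvPolynomial.eval z q‖ₑ ^ t⁻¹)) ∈ lelongClass S := by
  refine ⟨isPSH_log_enorm_rpow q (inv_pos.2 ht), ?_⟩
  -- The `+ 1` keeps `A` nonzero when `q = 0`, so that its logarithm is finite.
  set A : ℝ≥0∞ := (∑ α ∈ q.support, ‖q.coeff α‖ₑ) + 1 with hA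
  have hA0 : A ^ t⁻¹ ≠ 0 := by simp [A]
  have hAt : A ^ t⁻¹ ≠ ⊤ := by
    refine ENNReal.rpow_ne_top_of_nonneg (inv_nonneg.2 ht.le) ?_
    simp [A, ENNReal.sum_eq_top]
  refine ⟨Real.log (A ^ t⁻¹).toReal, fun z => ?_⟩
  have htorus : ∀ w ∈ complexTorus ι, ENNReal.log (‖MvPolynomial.eval w q‖ₑ ^ t⁻¹) ≤
      supportFun S (logAbs w) + (Real.log (A ^ t⁻¹).toReal : EReal) := by
    intro w hw
    rw [← ENNReal.log_pos_real hA0 hAt, ← EReal.log_exp (supportFun S (logAbs w)),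
      ← ENNReal.log_mul_add]
    refine ENNReal.log_monotone ?_
    have h1 := (enorm_eval_le_exp_supportFun ht.le hq hw).trans
      (mul_le_mul_left (self_le_add_right (∑ α ∈ q.support, ‖q.coeff α‖ₑ) 1) _)
    refine (ENNReal.rpow_le_rpow h1 (inv_nonneg.2 ht.le)).trans (le_of_eq ?_)
    rw [ENNReal.mul_rpow_of_nonneg _ _ (inv_nonneg.2 ht.le), ← ENNReal.rpow_mul,
      mul_inv_cancel₀ ht.ne', ENNReal.rpow_one, mul_comm]
  beta_reduce
  rw [logSupportFun]
  split_ifs with hz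
  · exact htorus z hz
  -- Off the torus the bound passes to the limsup, by density of the torus and continuity of `log
  -- |q|`.
  · have : (𝓝[complexTorus ι] z).NeBot := mem_closure_iff_nhdsWithin_neBot.1 (dense_complexTorus ι z)
    have hlim := ((continuous_log_enorm_rpow q t⁻¹).tendsto z).mono_left
      (nhdsWithin_le_nhds (s := complexTorus ι))
    rw [← hlim.limsup_eq]
    refine (limsup_le_limsup (eventually_nhdsWithin_of_forall htorus)).trans ?_
    refine (EReal.limsup_add_le (Or.inr ?_) (Or.inr ?_)).trans ?_ <;> simp

/-- For `t > 0`, `t⁻¹ * log |q / M|` is a competitor in the supremum; for `t = 0`, `q` is constant.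
-/
lemma enorm_eval_le_exp_siciakZakharyuta {ι : Type*} [Fintype ι] {S : Set (ι → ℝ)}
    {K : Set (ι → ℂ)} (hK : K.Nonempty) {t : ℝ} (ht : 0 ≤ t) {q : MvPolynomial ι ℂ}
    (hq : ∀ α ∈ q.support, (fun i => (α i : ℝ)) ∈ t • S)
    {M : ℝ} (hM : 0 < M) (hqK : ∀ w ∈ K, ‖MvPolynomial.eval w q‖ ≤ M) (z : ι → ℂ) :
    ‖MvPolynomial.eval z q‖ₑ ≤
      ENNReal.ofReal M * EReal.exp (siciakZakharyuta S K z) ^ t := by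
  rcases ht.eq_or_lt with rfl | ht
  · obtain ⟨w, hw⟩ := hK
    have hconst : MvPolynomial.eval z q = MvPolynomial.eval w q := by
      rw [MvPolynomial.eval_eq', MvPolynomial.eval_eq']
      refine Finset.sum_congr rfl fun α hα => ?_
      obtain ⟨x, -, hx⟩ := hq α hα
      have : ∀ i, α i = 0 := fun i => by
        have h := congrFun hx i
        simp only [zero_smul, Pi.zero_apply] at h
        exact_mod_cast h.symm
      simp [this]
    rw [hconst, ENNReal.rpow_zero, mul_one, ← ofReal_norm]
    exact ENNReal.ofReal_le_ofReal (hqK w hw)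
  · set p : MvPolynomial ι ℂ := MvPolynomial.C ((M⁻¹ : ℝ) : ℂ) * q with hp
    have hev : ∀ w, ‖MvPolynomial.eval w p‖ = M⁻¹ * ‖MvPolynomial.eval w q‖ := by
      intro w; simp [hp, abs_of_pos hM]
    have hps : ∀ α ∈ p.support, (fun i => (α i : ℝ)) ∈ t • S := by
      intro α hα
      refine hq α ?_
      rw [MvPolynomial.mem_support_iff] at hα ⊢
      rw [hp, MvPolynomial.coeff_C_mul] at hα
      exact right_ne_zero_of_mul hα
    have hle : ENNReal.log (‖MvPolynomial.eval z p‖ₑ ^ t⁻¹) ≤ siciakZakharyuta S K z := by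
      refine le_iSup₂ (f := fun (u : (ι → ℂ) → EReal)
        (_ : u ∈ {u | u ∈ lelongClass S ∧ ∀ w ∈ K, u w ≤ 0}) => u z)
        (fun z => ENNReal.log (‖MvPolynomial.eval z p‖ₑ ^ t⁻¹))
        ⟨log_enorm_rpow_mem_lelongClass ht hps, fun w hw => ?_⟩
      rw [ENNReal.log_le_zero_iff]
      refine ENNReal.rpow_le_one ?_ (inv_nonneg.2 ht.le)
      rw [← ofReal_norm, ENNReal.ofReal_le_one, hev, inv_mul_le_iff₀ hM, mul_one]
      exact hqK w hw
    have h2 := ENNReal.rpow_le_rpow (EReal.exp_monotone hle) ht.le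
    rw [ENNReal.exp_log, ← ENNReal.rpow_mul, inv_mul_cancel₀ ht.ne', ENNReal.rpow_one] at h2
    have h3 : ‖MvPolynomial.eval z q‖ₑ = ENNReal.ofReal M * ‖MvPolynomial.eval z p‖ₑ := by
      rw [← ofReal_norm, ← ofReal_norm, hev, ← ENNReal.ofReal_mul hM.le,
        mul_inv_cancel_left₀ hM.ne']
    rw [h3]
    gcongr

/-! ### Fekete points and adapted orthonormal bases -/

/-- The vectors `(f i w)`, `w ∈ K`, span `ℂ^d`: a functional killing them all would be a linear
relation on `K`. Some of them therefore form a basis. -/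
lemma exists_det_eval_ne_zero {X : Type*} {d : ℕ} {K : Set X} (f : Fin d → X → ℂ)
    (hf : ∀ c : Fin d → ℂ, (∀ w ∈ K, ∑ i, c i * f i w = 0) → c = 0) :
    ∃ p : Fin d → X, (∀ b, p b ∈ K) ∧ (Matrix.of fun b i => f i (p b)).det ≠ 0 := by
  set E : Set (Fin d → ℂ) := (fun w i => f i w) '' K with hE
  have hspan : Submodule.span ℂ E = ⊤ := by
    by_contra hne
    obtain ⟨φ, hφ, hle⟩ := Submodule.exists_le_ker_of_lt_top _ (lt_top_iff_ne_top.2 hne)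
    have hφv : ∀ v : Fin d → ℂ, φ v = ∑ i, φ (Pi.single i 1) * v i := by
      intro v
      conv_lhs => rw [pi_eq_sum_univ' v]
      simp [mul_comm]
    have hc := hf (fun i => φ (Pi.single i 1)) fun w hw => by
      rw [← hφv fun i => f i w]
      exact hle (Submodule.subset_span ⟨w, hw, rfl⟩)
    refine hφ (LinearMap.ext fun v => ?_)
    rw [hφv]
    simp [fun i => congrFun hc i]
  obtain ⟨s, hsE, hs, hli⟩ := exists_linearIndependent ℂ E
  let B : Module.Basis s ℂ (Fin d → ℂ) :=
    Module.Basis.mk hli (by rw [Subtype.range_coe_subtype, Set.ofPred_mem_eq, hs, hspan])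
  let e := B.indexEquiv (Pi.basisFun ℂ (Fin d))
  have hx : ∀ b : Fin d, ∃ w ∈ K, (fun i => f i w) = (e.symm b : Fin d → ℂ) := fun b =>
    hsE (e.symm b).2
  choose p hpK hp using hx
  refine ⟨p, hpK, ?_⟩
  have hrow : LinearIndependent ℂ (Matrix.of fun b i => f i (p b)).row := by
    have : (Matrix.of fun b i => f i (p b)).row = (fun x : s => (x : Fin d → ℂ)) ∘ e.symm := by
      funext b
      exact hp b
    rw [this]
    exact hli.comp _ e.symm.injective
  exact ((Matrix.isUnit_iff_isUnit_det _).1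
    (Matrix.linearIndependent_rows_iff_isUnit.1 hrow)).ne_zero

lemma exists_fekete {X : Type*} [TopologicalSpace X] {d : ℕ} {K : Set X} (hK : IsCompact K)
    (f : Fin d → X → ℂ) (hcont : ∀ i, Continuous (f i))
    (hf : ∀ c : Fin d → ℂ, (∀ w ∈ K, ∑ i, c i * f i w = 0) → c = 0) :
    ∃ p : Fin d → X, (∀ b, p b ∈ K) ∧ (Matrix.of fun b i => f i (p b)).det ≠ 0 ∧
      ∀ p' : Fin d → X, (∀ b, p' b ∈ K) → ‖(Matrix.of fun b i => f i (p' b)).det‖ ≤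
        ‖(Matrix.of fun b i => f i (p b)).det‖ := by
  obtain ⟨p₀, hp₀, hdet⟩ := exists_det_eval_ne_zero f hf
  have hc : Continuous fun p : Fin d → X => ‖(Matrix.of fun b i => f i (p b)).det‖ := by
    refine (Continuous.matrix_det ?_).norm
    exact continuous_matrix fun b i => (hcont i).comp (continuous_apply b)
  obtain ⟨p, hp, hmax⟩ := (isCompact_univ_pi fun _ : Fin d => hK).exists_isMaxOn
    ⟨p₀, fun b _ => hp₀ b⟩ hc.continuousOn
  refine ⟨p, fun b => hp b trivial, ?_, fun p' hp' => hmax fun b _ => hp' b⟩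
  exact norm_pos_iff.1 ((norm_pos_iff.2 hdet).trans_le (hmax fun b _ => hp₀ b))

/-- Polynomials in the span of `g` are identified with their values at Fekete points, and `q a` is
the one whose values form the `a`-th Gram–Schmidt vector. Inner products with that vector are the
coefficients, so they vanish for `i < a`. -/
lemma exists_adapted_basis {ι : Type*} {d : ℕ} {K : Set (ι → ℂ)} (hK : IsCompact K)
    (g : Fin d → MvPolynomial ι ℂ)
    (hg : ∀ c : Fin d → ℂ, (∀ w ∈ K, ∑ i, c i * MvPolynomial.eval w (g i) = 0) → c = 0) :
    ∃ (p : Fin d → ι → ℂ) (U : Fin d → Fin d → ℂ) (q : Fin d → MvPolynomial ι ℂ),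
      (∀ b, p b ∈ K) ∧ (∀ a b, ‖U a b‖ ≤ 1) ∧
      (∀ i, g i = ∑ a, (∑ b, U a b * MvPolynomial.eval (p b) (g i)) • q a) ∧
      (∀ a i, i < a → ∑ b, U a b * MvPolynomial.eval (p b) (g i) = 0) ∧
      (∀ a, q a ∈ Submodule.span ℂ (g '' Iic a)) ∧
      (∀ a, ∀ w ∈ K, ‖MvPolynomial.eval w (q a)‖ ≤ d) := by
  obtain ⟨p, hpK, hdet, hmax⟩ := exists_fekete hK (fun i w => MvPolynomial.eval w (g i))
    (fun i => MvPolynomial.continuous_eval (g i)) hg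
  set M : Matrix (Fin d) (Fin d) ℂ := Matrix.of fun b i => MvPolynomial.eval (p b) (g i) with hM
  set v : Fin d → EuclideanSpace ℂ (Fin d) :=
    fun i => WithLp.toLp 2 fun b => MvPolynomial.eval (p b) (g i) with hv
  have hli : LinearIndependent ℂ v := by
    have hcol : LinearIndependent ℂ M.col :=
      Matrix.linearIndependent_cols_iff_isUnit.2
        ((Matrix.isUnit_iff_isUnit_det _).2 (isUnit_iff_ne_zero.2 hdet))
    exact hcol.map' (WithLp.linearEquiv 2 ℂ (Fin d → ℂ)).symm.toLinearMap (LinearEquiv.ker _)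
  have hfin : Module.finrank ℂ (EuclideanSpace ℂ (Fin d)) = Fintype.card (Fin d) := by simp
  set u := InnerProductSpace.gramSchmidtOrthonormalBasis hfin v with hu
  have hexp : ∀ a i, ∑ b, star (u a b) * MvPolynomial.eval (p b) (g i) = inner ℂ (u a) (v i) := by
    intro a i
    simp [hv, PiLp.inner_apply, mul_comm]
  let B := basisOfLinearIndependentOfCardEqFinrank' v hli hfin.symm
  have hB : ∀ i, B i = v i := fun i => by simp [B]
  let Φ : EuclideanSpace ℂ (Fin d) →ₗ[ℂ] MvPolynomial ι ℂ := B.constr ℂ g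
  have hΦ : ∀ i, Φ (v i) = g i := fun i => by rw [← hB, Module.Basis.constr_basis]
  -- The Lagrange interpolation polynomials at the Fekete points.
  let L : Fin d → (ι → ℂ) → ℂ := fun b w =>
    MvPolynomial.eval w (Φ (EuclideanSpace.single b 1))
  have hL : ∀ x w, MvPolynomial.eval w (Φ x) = ∑ b, x b * L b w := by
    intro x w
    have : x = ∑ b, x b • EuclideanSpace.single b (1 : ℂ) := by
      ext b; simp [Finset.sum_apply, Pi.single_apply]
    conv_lhs => rw [this]
    simp [map_sum, L, MvPolynomial.smul_eval]
  have hLK : ∀ b, ∀ w ∈ K, ‖L b w‖ ≤ 1 := by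
    intro b w hw
    -- Cramer's rule: `L b w` is the ratio of the determinants with and without `p b` replaced by
    -- `w`, at most 1 in modulus by maximality.
    have h1 : (M.updateRow b fun i => MvPolynomial.eval w (g i)).det = L b w * M.det := by
      rw [← smul_eq_mul, ← Matrix.det_updateRow_sum M b fun b' => L b' w]
      congr 2
      funext i
      rw [← hΦ i, hL]
      simp [hv, hM, mul_comm, Finset.sum_apply]
    have h2 := hmax (Function.update p b w) fun b' => by
      rcases eq_or_ne b' b with rfl | h
      · simpa using hw
      · simpa [h] using hpK b'
    have h3 : (Matrix.of fun b' i => MvPolynomial.eval (Function.update p b w b') (g i)) =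
        M.updateRow b fun i => MvPolynomial.eval w (g i) := by
      ext b' i
      rcases eq_or_ne b' b with rfl | h
      · simp
      · simp [h, hM]
    rw [h3, h1, norm_mul] at h2
    exact le_of_mul_le_mul_right (by simpa using h2) (norm_pos_iff.2 hdet)
  have hu1 : ∀ a b, ‖u a b‖ ≤ 1 := fun a b =>
    (PiLp.norm_apply_le (u a) b).trans (u.orthonormal.1 a).le
  refine ⟨p, fun a b => star (u a b), fun a => Φ (u a), hpK, fun a b => by simpa using hu1 a b,
    fun i => ?_, fun a i hia => ?_, fun a => ?_, fun a w hw => ?_⟩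
  · simp only [hexp]
    conv_lhs => rw [← hΦ i, ← u.sum_repr' (v i)]
    simp [map_sum]
  · rw [hexp]
    exact InnerProductSpace.gramSchmidtOrthonormalBasis_inv_triangular hfin v hia
  · have hne : InnerProductSpace.gramSchmidtNormed ℂ v a ≠ 0 := by
      rw [← norm_ne_zero_iff, InnerProductSpace.gramSchmidtNormed_unit_length a hli]
      exact one_ne_zero
    have hmem : u a ∈ Submodule.span ℂ (v '' Iic a) := by
      rw [hu, InnerProductSpace.gramSchmidtOrthonormalBasis_apply hfin hne]
      exact Submodule.smul_mem _ _ (InnerProductSpace.gramSchmidt_mem_span ℂ v le_rfl)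
    have := Submodule.mem_map_of_mem (f := Φ) hmem
    rw [Submodule.map_span, ← image_comp] at this
    convert this using 3
    exact (hΦ _).symm
  · rw [hL]
    calc ‖∑ b, u a b * L b w‖ ≤ ∑ b : Fin d, (1 : ℝ) := by
          refine (norm_sum_le _ _).trans (Finset.sum_le_sum fun b _ => ?_)
          rw [norm_mul]
          exact mul_le_one₀ (hu1 a b) (norm_nonneg _) (hLK b w hw)
      _ = d := by simp

/-! ### Ordering the monomials along the chain `t • S` -/

/-- Sort by the size of `D α`, the intersection of all members of the chain that contain `α`. If `C
t` contains `e b` but not `e a`, then `D (e b)` is strictly smaller than `D (e a)`. -/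
lemma exists_equiv_fin_of_monotone {A : Type*} [Fintype A] {d : ℕ}
    (hd : Fintype.card A = d) {P : Type*} [LinearOrder P]
    {C : P → Set A} (hC : Monotone C) :
    ∃ e : Fin d ≃ A, ∀ t a b, a ≤ b → e b ∈ C t → e a ∈ C t := by
  classical
  subst hd
  let D : A → Finset A := fun α => {β | ∀ s, α ∈ C s → β ∈ C s}
  let e₀ := (Fintype.equivFin A).symm
  let σ := Tuple.sort fun a => (D (e₀ a)).card
  refine ⟨σ.trans e₀, fun t a b hab hb => ?_⟩
  by_contra ha
  have hlt : D (e₀ (σ b)) ⊂ D (e₀ (σ a)) := by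
    refine Finset.ssubset_iff_subset_ne.2 ⟨fun β hβ => ?_, fun h => ?_⟩
    · simp only [D, Finset.mem_filter, Finset.mem_univ, true_and] at hβ ⊢
      intro s hs
      refine hβ s ?_
      rcases le_total t s with hts | hst
      · exact hC hts hb
      · exact (ha (hC hst hs)).elim
    · have : e₀ (σ a) ∈ D (e₀ (σ b)) := by simp [h, D]
      simp only [D, Finset.mem_filter, Finset.mem_univ, true_and] at this
      exact ha (this t hb)
  exact absurd (Tuple.monotone_sort (fun a => (D (e₀ a)).card) hab)
    (not_le.2 (Finset.card_lt_card hlt))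

lemma Convex.smul_subset_smul_of_le {E : Type*} [AddCommGroup E] [Module ℝ E] {S : Set E}
    (hS : Convex ℝ S) (h0 : 0 ∈ S) {s t : ℝ} (hs : 0 ≤ s) (hst : s ≤ t) : s • S ⊆ t • S := by
  rcases hs.eq_or_lt with rfl | hs
  · rintro _ ⟨x, hx, rfl⟩
    exact ⟨0, h0, by simp⟩
  · have ht := hs.trans_le hst
    rintro _ ⟨x, hx, rfl⟩
    refine ⟨(s / t) • x, hS.smul_mem_of_zero_mem h0 hx ⟨by positivity, (div_le_one ht).2 hst⟩, ?_⟩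
    simp only [smul_smul]
    rw [mul_div_cancel₀ _ ht.ne']

/-- Expansion of the monomials with exponents at most `N` in polynomials that are adapted to the
chain `t • S` and of moderate growth, with coefficients given by point values on `K`. -/
lemma exists_expansion_monomials {n : ℕ} (N : ℕ) {K : Set (Fin n → ℂ)} (hK : IsCompact K)
    (hKp : ¬ IsPluripolar K) {S : Set (Fin n → ℝ)} (hS : Convex ℝ S) (hS0 : 0 ∈ S) :
    ∃ (p : Fin ((N + 1) ^ n) → Fin n → ℂ) (U : Fin ((N + 1) ^ n) → Fin ((N + 1) ^ n) → ℂ)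
      (q : Fin ((N + 1) ^ n) → (Fin n → ℂ) → ℂ),
      (∀ b, p b ∈ K) ∧ (∀ a b, ‖U a b‖ ≤ 1) ∧
      (∀ γ : Fin n → ℕ, (∀ i, γ i ≤ N) → ∀ z : Fin n → ℂ,
        ∏ i, z i ^ γ i = ∑ a, (∑ b, U a b * ∏ i, p b i ^ γ i) * q a z) ∧
      (∀ γ : Fin n → ℕ, (∀ i, γ i ≤ N) → ∀ t : ℝ, 0 ≤ t → (fun i => (γ i : ℝ)) ∈ t • S →
        ∀ a, ∑ b, U a b * ∏ i, p b i ^ γ i ≠ 0 → ∀ z, ‖q a z‖ₑ ≤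
          (((N + 1) ^ n : ℕ) : ℝ≥0∞) * EReal.exp (siciakZakharyuta S K z) ^ t) := by
  let C : NNReal → Set (Fin n → Fin (N + 1)) :=
    fun t => {β | (fun i => ((β i : ℕ) : ℝ)) ∈ (t : ℝ) • S}
  have hC : Monotone C := fun s t hst β hβ =>
    hS.smul_subset_smul_of_le hS0 s.2 (NNReal.coe_le_coe.2 hst) hβ
  obtain ⟨e, he⟩ := exists_equiv_fin_of_monotone
    (show Fintype.card (Fin n → Fin (N + 1)) = (N + 1) ^ n by simp) hC
  let E : Fin ((N + 1) ^ n) → Fin n →₀ ℕ :=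
    fun a => Finsupp.equivFunOnFinite.symm fun i => (e a i : ℕ)
  have hE : ∀ a i, E a i = e a i := fun a i => rfl
  have hEinj : Function.Injective E := fun a b hab => e.injective <| funext fun i =>
    Fin.ext (by rw [← hE, ← hE, hab])
  have hEsurj : ∀ γ : Fin n → ℕ, (∀ i, γ i ≤ N) → ∃ a, ∀ i, γ i = E a i := fun γ hγ =>
    ⟨e.symm fun i => ⟨γ i, Nat.lt_succ_of_le (hγ i)⟩, fun i => by simp [hE]⟩
  let g : Fin ((N + 1) ^ n) → MvPolynomial (Fin n) ℂ := fun a => MvPolynomial.monomial (E a) 1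
  have hgeval : ∀ a w, MvPolynomial.eval w (g a) = ∏ i, w i ^ E a i := by
    intro a w
    simp [g, MvPolynomial.eval_monomial, Finsupp.prod_fintype]
  have hg : ∀ c : Fin ((N + 1) ^ n) → ℂ,
      (∀ w ∈ K, ∑ i, c i * MvPolynomial.eval w (g i) = 0) → c = 0 := by
    intro c hc
    have h0 : ∑ i, c i • g i = 0 := by
      by_contra hne
      obtain ⟨w, hw, hw'⟩ := exists_eval_ne_zero_of_not_isPluripolar hKp hne
      refine hw' ?_
      rw [← hc w hw]
      simp [MvPolynomial.smul_eval]
    funext a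
    have := congrArg (MvPolynomial.coeff (E a)) h0
    simpa [g, MvPolynomial.coeff_sum, MvPolynomial.coeff_monomial, hEinj.eq_iff] using this
  have hKne : K.Nonempty := by
    obtain ⟨w, hw, -⟩ := exists_eval_ne_zero_of_not_isPluripolar hKp
      (one_ne_zero (α := MvPolynomial (Fin n) ℂ))
    exact ⟨w, hw⟩
  obtain ⟨p, U, q, hpK, hU, hexp, htri, hspan, hbd⟩ := exists_adapted_basis hK g hg
  refine ⟨p, U, fun a z => MvPolynomial.eval z (q a), hpK, hU, fun γ hγ z => ?_,
    fun γ hγ t ht hγt a hne z => ?_⟩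
  · obtain ⟨i, hi⟩ := hEsurj γ hγ
    simp only [hi, ← hgeval]
    conv_lhs => rw [hexp i]
    simp [MvPolynomial.smul_eval]
  · obtain ⟨i, hi⟩ := hEsurj γ hγ
    simp only [hi, ← hgeval] at hne hγt
    have hai : a ≤ i := not_lt.1 fun h => hne (htri a i h)
    -- The monomials up to index `a ≤ i` all lie in `t • S`, an initial segment containing index
    -- `i`.
    have hsupp : ∀ α ∈ (q a).support, (fun i => (α i : ℝ)) ∈ t • S := by
      have hle : Submodule.span ℂ (g '' Iic a) ≤
          MvPolynomial.restrictSupport ℂ {α | (fun i => (α i : ℝ)) ∈ t • S} := by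
        rw [Submodule.span_le]
        rintro _ ⟨b, hb, rfl⟩
        refine (MvPolynomial.monomial_mem_restrictSupport ℂ).2 (Or.inl ?_)
        exact he ⟨t, ht⟩ b i (le_trans hb hai) hγt
      intro α hα
      exact hle (hspan a) hα
    have := enorm_eval_le_exp_siciakZakharyuta hKne ht hsupp
      (M := (((N + 1) ^ n : ℕ) : ℝ)) (by positivity) (hbd a) z
    rwa [ENNReal.ofReal_natCast] at this

/-! ### The product inequality -/

lemma EReal.exp_sum {ι : Type*} (s : Finset ι) (f : ι → EReal) :
    EReal.exp (∑ i ∈ s, f i) = ∏ i ∈ s, EReal.exp (f i) := by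
  classical
  induction s using Finset.induction_on with
  | empty => simp
  | insert a s ha ih => rw [Finset.sum_insert ha, Finset.prod_insert ha, EReal.exp_add, ih]

/-- The convention `0 * ∞ = 0` matches `∞ ^ 0 = 1`, so infinite values need no separate treatment.
-/
lemma prod_exp_rpow_le_exp_supportFun {ι : Type*} [Fintype ι] {T : Set (ι → ℝ)} {x : ι → ℝ}
    (hx : x ∈ T) (v : ι → EReal) (m : ℕ) :
    ∏ j, EReal.exp (v j) ^ ((m : ℝ) * x j) ≤ EReal.exp (m * supportFun T v) := by
  have hle : ∑ j, (x j : EReal) * v j ≤ supportFun T v :=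
    le_iSup₂ (f := fun (y : ι → ℝ) (_ : y ∈ T) => ∑ i, (y i : EReal) * v i) x hx
  have h1 : ∏ j, EReal.exp (v j) ^ ((m : ℝ) * x j) =
      EReal.exp (∑ j, (x j : EReal) * v j) ^ m := by
    rw [EReal.exp_sum, ← Finset.prod_pow]
    refine Finset.prod_congr rfl fun j _ => ?_
    rw [mul_comm (x j : EReal), EReal.exp_mul, mul_comm (m : ℝ), ENNReal.rpow_mul,
      ENNReal.rpow_natCast]
  rw [h1, EReal.exp_nmul]
  gcongr

section Product

variable {l : ℕ} {n : Fin l → ℕ} {T : Set (Fin l → ℝ)} {S : ∀ j, Set (Fin (n j) → ℝ)}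

/-- For convex `S j` and nonnegative `s`, `t`, one has `(s + t) • S j = s • S j + t • S j`. -/
lemma convex_scaledProdUnion (hT0 : ∀ x ∈ T, ∀ j, 0 ≤ x j) (hT : Convex ℝ T)
    (hS : ∀ j, Convex ℝ (S j)) : Convex ℝ (scaledProdUnion T S) := by
  intro s hs s' hs' a b ha hb hab
  simp only [scaledProdUnion, blockProd, mem_iUnion, mem_ofPred_eq, exists_prop] at hs hs' ⊢
  obtain ⟨x, hx, hxs⟩ := hs
  obtain ⟨x', hx', hxs'⟩ := hs'
  refine ⟨a • x + b • x', hT hx hx' ha hb hab, fun j => ?_⟩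
  have h0 := mul_nonneg ha (hT0 x hx j)
  have h0' := mul_nonneg hb (hT0 x' hx' j)
  rw [Pi.add_apply, Pi.smul_apply, Pi.smul_apply, smul_eq_mul, smul_eq_mul,
    (hS j).add_smul h0 h0', mul_smul, mul_smul]
  exact add_mem_add (smul_mem_smul_set (hxs j)) (smul_mem_smul_set (hxs' j))

lemma exists_block_mem_of_mem_smul_scaledProdUnion {m : ℕ} {γ : (Σ j, Fin (n j)) → ℝ}
    (hγ : γ ∈ (m : ℝ) • scaledProdUnion T S) :
    ∃ x ∈ T, ∀ j, block γ j ∈ ((m : ℝ) * x j) • S j := by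
  obtain ⟨s, hs, rfl⟩ := hγ
  simp only [scaledProdUnion, blockProd, mem_iUnion, mem_ofPred_eq, exists_prop] at hs
  obtain ⟨x, hx, hxs⟩ := hs
  refine ⟨x, hx, fun j => ?_⟩
  rw [mul_smul]
  exact smul_mem_smul_set (hxs j)

lemma mul_mem_polyClass {ι : Type*} {S : Set (ι → ℝ)} (hS : Convex ℝ S) {m k : ℕ}
    {f g : MvPolynomial ι ℂ} (hf : f ∈ polyClass S m) (hg : g ∈ polyClass S k) :
    f * g ∈ polyClass S (m + k) := by
  classical
  intro α hα
  obtain ⟨β, hβ, γ, hγ, rfl⟩ := Finset.mem_add.1 (MvPolynomial.support_mul f g hα)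
  rw [Nat.cast_add, hS.add_smul (Nat.cast_nonneg _) (Nat.cast_nonneg _)]
  convert add_mem_add (hf β hβ) (hg γ hγ) using 1
  ext i
  simp

lemma pow_mem_polyClass {ι : Type*} {S : Set (ι → ℝ)} (hS : Convex ℝ S) {m : ℕ}
    {f : MvPolynomial ι ℂ} (hf : f ∈ polyClass S m) {k : ℕ} (hk : 1 ≤ k) :
    f ^ k ∈ polyClass S (m * k) := by
  induction k, hk using Nat.le_induction with
  | base => simpa using hf
  | succ k _ ih => exact mul_mem_polyClass hS ih hf

lemma supNormOn_pow_le {ι : Type*} (K : Set (ι → ℂ)) (f : MvPolynomial ι ℂ) (k : ℕ) :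
    supNormOn K (f ^ k) ≤ supNormOn K f ^ k := by
  refine iSup₂_le fun w hw => ?_
  rw [map_pow, enorm_pow]
  gcongr
  exact le_iSup₂ (f := fun (w : ι → ℂ) (_ : w ∈ K) => ‖MvPolynomial.eval w f‖ₑ) w hw

/-- The product inequality up to a factor that is polynomial in the degree. -/
lemma enorm_eval_le_mul_supNormOn_mul_exp {K : ∀ j, Set (Fin (n j) → ℂ)}
    (hK : ∀ j, IsCompact (K j)) (hKp : ∀ j, ¬ IsPluripolar (K j))
    (hT0 : ∀ x ∈ T, ∀ j, 0 ≤ x j) (hS : ∀ j, Convex ℝ (S j)) (hS0 : ∀ j, 0 ∈ S j)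
    {m : ℕ} {f : MvPolynomial (Σ j, Fin (n j)) ℂ} (hf : f ∈ polyClass (scaledProdUnion T S) m)
    {N : ℕ} (hN : f.totalDegree ≤ N) (z : (Σ j, Fin (n j)) → ℂ) :
    ‖MvPolynomial.eval z f‖ₑ ≤ (∏ j, (((N + 1) ^ n j : ℕ) : ℝ≥0∞)) ^ 3 *
      (supNormOn (blockProd K) f *
        EReal.exp (m * supportFun T fun j => siciakZakharyuta (S j) (K j) (block z j))) := by
  choose p U q hpK hU hexp hbd using fun j =>
    exists_expansion_monomials N (hK j) (hKp j) (hS j) (hS0 j)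
  set D : ℝ≥0∞ := ∏ j, (((N + 1) ^ n j : ℕ) : ℝ≥0∞) with hD
  set Ex := EReal.exp (m * supportFun T fun j => siciakZakharyuta (S j) (K j) (block z j))
  have hγN : ∀ γ ∈ f.support, ∀ i, γ i ≤ N := fun γ hγ i =>
    (Finsupp.le_degree i γ).trans ((MvPolynomial.le_totalDegree hγ).trans hN)
  let I := ∀ j, Fin ((N + 1) ^ n j)
  have hI : ((Fintype.card I : ℕ) : ℝ≥0∞) = D := by simp [I, D, Fintype.card_pi]
  let W : ∀ j, ((Σ j, Fin (n j)) →₀ ℕ) → Fin ((N + 1) ^ n j) → ℂ :=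
    fun j γ a => ∑ b, U j a b * ∏ i, p j b i ^ γ ⟨j, i⟩
  let P : I → (Σ j, Fin (n j)) → ℂ := fun β s => p s.1 (β s.1) s.2
  let c : I → ℂ := fun α => ∑ γ ∈ f.support, f.coeff γ * ∏ j, W j γ (α j)
  have hfz : MvPolynomial.eval z f = ∑ α : I, c α * ∏ j, q j (α j) (block z j) := by
    rw [MvPolynomial.eval_eq']
    simp only [c, Finset.sum_mul]
    rw [Finset.sum_comm]
    refine Finset.sum_congr rfl fun γ hγ => ?_
    rw [Fintype.prod_sigma]
    have : ∀ j, ∏ i, z ⟨j, i⟩ ^ γ ⟨j, i⟩ = ∑ a, W j γ a * q j a (block z j) := fun j =>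
      hexp j (fun i => γ ⟨j, i⟩) (fun i => hγN γ hγ _) (block z j)
    simp only [this]
    rw [Finset.prod_univ_sum, Fintype.piFinset_univ, Finset.mul_sum]
    refine Finset.sum_congr rfl fun α _ => ?_
    rw [Finset.prod_mul_distrib, mul_assoc]
  -- Multiplying out the block coefficients reassembles `f` at the product Fekete points `P β`.
  have hcP : ∀ α : I, c α = ∑ β : I, (∏ j, U j (α j) (β j)) * MvPolynomial.eval (P β) f := by
    intro α
    simp only [c, W, MvPolynomial.eval_eq', Finset.mul_sum, Finset.prod_univ_sum,
      Fintype.piFinset_univ]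
    rw [Finset.sum_comm]
    refine Finset.sum_congr rfl fun β _ => Finset.sum_congr rfl fun γ _ => ?_
    rw [Fintype.prod_sigma, Finset.prod_mul_distrib]
    simp only [P]
    ring
  have hcle : ∀ α, ‖c α‖ₑ ≤ D * supNormOn (blockProd K) f := by
    intro α
    rw [hcP]
    refine (enorm_sum_le _ _).trans ((Finset.sum_le_card_nsmul Finset.univ _ _ fun β _ => ?_).trans
      (le_of_eq (by rw [nsmul_eq_mul, Finset.card_univ, hI])))
    rw [enorm_mul]
    have h1 : ‖∏ j, U j (α j) (β j)‖ₑ ≤ 1 := by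
      rw [← ofReal_norm, ENNReal.ofReal_le_one, norm_prod]
      exact Finset.prod_le_one (fun _ _ => norm_nonneg _) fun j _ => hU j _ _
    refine (mul_le_mul_left h1 _).trans ?_
    rw [one_mul]
    exact le_iSup₂ (f := fun (w : (Σ j, Fin (n j)) → ℂ) (_ : w ∈ blockProd K) =>
      ‖MvPolynomial.eval w f‖ₑ) (P β) fun j => hpK j (β j)
  have hterm : ∀ α : I, ‖c α * ∏ j, q j (α j) (block z j)‖ₑ ≤
      D * supNormOn (blockProd K) f * (D * Ex) := by
    intro α
    by_cases hcα : c α = 0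
    · simp [hcα]
    obtain ⟨γ, hγ, hne⟩ := Finset.exists_ne_zero_of_sum_ne_zero hcα
    have hW : ∀ j, W j γ (α j) ≠ 0 := fun j h =>
      hne (by rw [Finset.prod_eq_zero (Finset.mem_univ j) h, mul_zero])
    obtain ⟨x, hx, hxγ⟩ := exists_block_mem_of_mem_smul_scaledProdUnion (hf γ hγ)
    rw [enorm_mul]
    refine mul_le_mul' (hcle α) ?_
    calc ‖∏ j, q j (α j) (block z j)‖ₑ = ∏ j, ‖q j (α j) (block z j)‖ₑ := by
          rw [← ofReal_norm, norm_prod, ENNReal.ofReal_prod_of_nonneg fun _ _ => norm_nonneg _]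
          simp
      _ ≤ ∏ j, ((((N + 1) ^ n j : ℕ) : ℝ≥0∞) *
            EReal.exp (siciakZakharyuta (S j) (K j) (block z j)) ^ ((m : ℝ) * x j)) :=
          Finset.prod_le_prod' fun j _ => hbd j (fun i => γ ⟨j, i⟩) (fun i => hγN γ hγ _) _
            (mul_nonneg (Nat.cast_nonneg _) (hT0 x hx j)) (hxγ j) (α j) (hW j) (block z j)
      _ ≤ D * Ex := by
          rw [Finset.prod_mul_distrib]
          gcongr
          exact prod_exp_rpow_le_exp_supportFun hx _ m
  rw [hfz]
  refine (enorm_sum_le _ _).trans ((Finset.sum_le_card_nsmul Finset.univ _ _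
    fun α _ => hterm α).trans (le_of_eq ?_))
  -- The three factors `D` come from the coefficient bound, the growth of the `q`, and the number of
  -- terms.
  rw [nsmul_eq_mul, Finset.card_univ, hI]
  ring

end Product

/-! ### Removing the polynomial factor -/

/-- If `b < a`, then `(a / b) ^ k` outgrows every power of `k`; the cases `a = ∞` and `b = 0` are
excluded by `k = 1`. -/
lemma ENNReal.le_of_forall_pow_le_mul_pow {a b : ℝ≥0∞} {C p : ℕ}
    (h : ∀ k : ℕ, 1 ≤ k → a ^ k ≤ ((C * k + 1 : ℕ) : ℝ≥0∞) ^ p * b ^ k) : a ≤ b := by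
  by_contra! hlt
  have hb : b ≠ ⊤ := hlt.ne_top
  have ha : a ≠ ⊤ := by
    intro ha
    have h1 := h 1 le_rfl
    rw [pow_one, pow_one, ha, top_le_iff] at h1
    exact ENNReal.mul_ne_top (ENNReal.pow_ne_top (ENNReal.natCast_ne_top _)) hb h1
  lift a to NNReal using ha
  lift b to NNReal using hb
  have hab : (b : ℝ) < a := by exact_mod_cast hlt
  have hreal : ∀ k : ℕ, 1 ≤ k → (a : ℝ) ^ k ≤ ((C * k + 1 : ℕ) : ℝ) ^ p * (b : ℝ) ^ k := by
    intro k hk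
    exact_mod_cast h k hk
  rcases b.2.eq_or_lt with hb0 | hb0
  · have := hreal 1 le_rfl
    rw [show (b : ℝ) = 0 from hb0.symm] at this hab
    rw [pow_one, pow_one, mul_zero] at this
    exact absurd hab this.not_gt
  · have hb0 : (0 : ℝ) < b := hb0
    have hr : 1 < (a : ℝ) / b := (one_lt_div hb0).2 hab
    have hle : ∀ k : ℕ, 1 ≤ k →
        (1 : ℝ) ≤ ((C : ℝ) + 1) ^ p * ((k : ℝ) ^ p / ((a : ℝ) / b) ^ k) := by
      intro k hk
      have h1 := hreal k hk
      have hk' : (1 : ℝ) ≤ k := by exact_mod_cast hk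
      have h2 : ((C * k + 1 : ℕ) : ℝ) ^ p ≤ (((C : ℝ) + 1) * k) ^ p := by
        refine pow_le_pow_left₀ (by positivity) ?_ p
        push_cast
        linarith
      have hbk : (0 : ℝ) < (b : ℝ) ^ k := pow_pos hb0 k
      rw [← mul_div_assoc, ← mul_pow, le_div_iff₀ (pow_pos (one_pos.trans hr) k), one_mul, div_pow,
        div_le_iff₀ hbk]
      exact h1.trans (mul_le_mul_of_nonneg_right h2 hbk.le)
    have hlim := (tendsto_pow_const_div_const_pow_of_one_lt p hr).const_mul (((C : ℝ) + 1) ^ p)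
    rw [mul_zero] at hlim
    have := ge_of_tendsto hlim (eventually_atTop.2 ⟨1, hle⟩)
    linarith

theorem proposition3p1 {l : ℕ} {n : Fin l → ℕ}
    (K : ∀ j, Set (Fin (n j) → ℂ))
    (hK_compact : ∀ j, IsCompact (K j))
    (hK_nonpluripolar : ∀ j, ¬ IsPluripolar (K j))
    (T : Set (Fin l → ℝ))
    (hT_nonneg : ∀ x ∈ T, ∀ j, 0 ≤ x j)
    (hT_compact : IsCompact T) (hT_convex : Convex ℝ T)
    (S : ∀ j, Set (Fin (n j) → ℝ))
    (hS_nonneg : ∀ j, ∀ s ∈ S j, ∀ i, 0 ≤ s i)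
    (hS_compact : ∀ j, IsCompact (S j)) (hS_convex : ∀ j, Convex ℝ (S j))
    (hS_zero : ∀ j, 0 ∈ S j)
    (m : ℕ) (f : MvPolynomial (Σ j, Fin (n j)) ℂ)
    (hf : f ∈ polyClass (scaledProdUnion T S) m)
    (z : (Σ j, Fin (n j)) → ℂ) :
    ‖MvPolynomial.eval z f‖ₑ ≤
      supNormOn (blockProd K) f *
        EReal.exp ((m : EReal) *
          supportFun T (fun j => siciakZakharyuta (S j) (K j) (block z j))) := by
  -- `N = f.totalDegree * k` bounds the degree of `f ^ k`, and `D ^ 3` is then `N + 1` to the power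
  -- `3 * ∑ n j`.
  refine ENNReal.le_of_forall_pow_le_mul_pow (C := f.totalDegree) (p := (∑ j, n j) * 3)
    fun k hk => ?_
  have hfk := pow_mem_polyClass (convex_scaledProdUnion hT_nonneg hT_convex hS_convex) hf hk
  have hdeg : (f ^ k).totalDegree ≤ f.totalDegree * k :=
    (MvPolynomial.totalDegree_pow f k).trans_eq (mul_comm _ _)
  have h := enorm_eval_le_mul_supNormOn_mul_exp hK_compact hK_nonpluripolar hT_nonneg hS_convex
    hS_zero hfk hdeg z
  rw [map_pow, enorm_pow] at h
  refine h.trans ?_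
  have hexp : EReal.exp (((m * k : ℕ) : EReal) *
      supportFun T fun j => siciakZakharyuta (S j) (K j) (block z j)) =
      EReal.exp ((m : EReal) *
        supportFun T fun j => siciakZakharyuta (S j) (K j) (block z j)) ^ k := by
    rw [EReal.exp_nmul, EReal.exp_nmul, pow_mul]
  have hprod : (∏ j, (((f.totalDegree * k + 1) ^ n j : ℕ) : ℝ≥0∞)) =
      ((f.totalDegree * k + 1 : ℕ) : ℝ≥0∞) ^ ∑ j, n j := by
    simp only [Nat.cast_pow]
    exact Finset.prod_pow_eq_pow_sum _ _ _
  rw [hexp, hprod, ← pow_mul, mul_pow]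
  gcongr
  exact supNormOn_pow_le _ _ _
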